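/- Consider a finite network whose interference graph is complete $K$-partite with non-empty components $V_1,\dots,V_K$ (two nodes interfere if and only if they lie in different components), $M_k=|V_k|$ and $M=\max_k M_k$. Its state is $(U,L)$, where the set of active nodes $U$ is an independent set of the graph and $L_i\in\{0,1,2,\dots\}$ is the number of packets at node $i$. It evolves as a continuous-time Markov chain with fixed activation rates $\nu_i>0$ and unit service rates: a packet arrives at node $i$ ($L_i\to L_i+1$) at rate $\lambda_i$; a node $i$ that is inactive and has no active neighbour becomes active at rate $\nu_i$; an active node $i$ de-activates at rate $1$, and then $L_i\to\max(L_i-1,0)$. Suppose $\lambda_i=\hat\rho_k\ge 0$ for all $i\in V_k$, and put $\rho=\sum_{k=1}^K\hat\rho_k$ and $\rho_{\min}=\min_k\hat\rho_k$. Assume that the system is stable, i.e. that the chain has a stationary probability distribution, and let $\mathbb{E}[L_i]\in[0,\infty]$ be the mean of $L_i$ under it. Then $\rho<1$ and the following hold. (1) If $K\ge 2$, then for every $k$, every $S\subseteq V_k$ and all weights $w_i\ge 0$ with $\sum_{i\in S}w_i\lambda_i>0$, $$\sum_{i\in S} w_i\,\mathbb{E}[L_i] \;>\; \frac{1}{2M}\,\rho_{\min}^{M+1}\,\sum_{i\in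 S} w_i\lambda_i\,\left(\frac{1}{1-\rho}\right)^{M-1}.$$ (2) In the symmetric case, where $M_k=M$ and $\hat\rho_k=\rho/K$ for all $k$, if $\rho>0$, then for every node $i$, $$\mathbb{E}[L_i] \;>\; \frac{(K-1)^2\rho^{M+2}}{2MK^{M+1}\,(K-(K-1)\rho)}\left(\frac{1}{1-\rho}\right)^{M-1}.$$ -/

import Mathlib

open scoped ENNReal

noncomputable section

namespace RandomAccess

variable {V : Type*} [Fintype V] [DecidableEq V]

/-- Feasible joint activity states: the set of active nodes is an independent set of the
interference graph. -/
abbrev Activity (G : SimpleGraph V) : Type _ :=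
  {u : Finset V // G.IsIndepSet (u : Set V)}

/-- States `(U, L)` of the network: the joint activity state and the queue length of each node. -/
abbrev State (G : SimpleGraph V) : Type _ := Activity G × (V → ℕ)

/-- Node `i` is unblocked when neither the node itself nor any of its neighbours is active. -/
def Unblocked (G : SimpleGraph V) (u : Finset V) (i : V) : Prop :=
  i ∉ u ∧ ∀ j, G.Adj i j → j ∉ u

/-- The queue lengths after an arrival at node `i`. -/
def arrive (l : V → ℕ) (i : V) : V → ℕ := Function.update l i (l i + 1)

/-- The queue lengths after a transmission completion at node `i`; an empty queue stays empty
(the completed transmission was a dummy one; the subtraction is truncated). -/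
def depart (l : V → ℕ) (i : V) : V → ℕ := Function.update l i (l i - 1)

open Classical in
/-- Transition rates of the Markov process `(U(t), L(t))` with arrival rates `lam`, service rates
`mu`, activation functions `f` and de-activation functions `g`.  The four terms are: an arrival,
an activation, a transmission completion followed back-to-back by another transmission, and a
transmission completion followed by a back-off period. -/
def rate (G : SimpleGraph V) (lam mu : V → ℝ) (f g : V → ℕ → ℝ) (x y : State G) : ℝ :=
  ∑ i : V,
    ((if y.1.1 = x.1.1 ∧ y.2 = arrive x.2 i then lam i else 0)
    + (if Unblocked G x.1.1 i ∧ y.1.1 = insert i x.1.1 ∧ y.2 = x.2 then f i (x.2 i) else 0)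
    + (if i ∈ x.1.1 ∧ y.1.1 = x.1.1 ∧ y.2 = depart x.2 i then mu i - g i (x.2 i) else 0)
    + (if i ∈ x.1.1 ∧ y.1.1 = x.1.1.erase i ∧ y.2 = depart x.2 i then g i (x.2 i) else 0))

/-- The case of fixed activation rates `nu` with unit service rates and certain back-off after
each transmission: `f i ≡ nu i`, `g i ≡ 1`, `mu i = 1`. -/
def fixedRate (G : SimpleGraph V) (lam nu : V → ℝ) : State G → State G → ℝ :=
  rate G lam (fun _ => 1) (fun i _ => nu i) (fun _ _ => 1)

/-- `p` is a stationary distribution of the continuous-time Markov chain with transition rates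
`q`: the global balance equations hold.  With bounded rates, as
for fixed activation rates, this is invariance under the transition semigroup, and an irreducible
chain is positive recurrent (the system is stable) exactly when such a `p` exists. -/
def IsStationary {X : Type*} (q : X → X → ℝ) (p : PMF X) : Prop :=
  ∀ x, p x * ∑' y, ENNReal.ofReal (q x y) = ∑' y, p y * ENNReal.ofReal (q y x)

/-- The stationary mean number `E[L_i]` of packets at node `i`, a value in `[0, ∞]`. -/
def meanQueue {G : SimpleGraph V} (p : PMF (State G)) (i : V) : ℝ≥0∞ :=
  ∑' x : State G, p x * (x.2 i : ℝ≥0∞)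

/-- The size `M_k` of the `k`-th component, `c` mapping each node to its component. -/
def compSize {K : ℕ} (c : V → Fin K) (k : Fin K) : ℕ :=
  (Finset.univ.filter fun i => c i = k).card

/-- The maximum component size `M`. -/
def maxCompSize {K : ℕ} (c : V → Fin K) : ℕ :=
  Finset.univ.sup (compSize c)

end RandomAccess

end

noncomputable section

set_option linter.unusedSectionVars false

/-! Fix a node `i` and test the global balance equations, on each event `U = u`, against functions
of `L_i`. The constant function shows that the activity process is reversible, with stationary law
proportional to the product of the `nu` over the active nodes (`prob_eq_weight`). The function `L_i`
shows that `g u = E[L_i; U = u] / weight nu u` solves a Poisson equation on an electrical network of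
activity states: the source is `lam i * P(U = u)`, and the departure term is absent at every
non-idle state where another component is active (`queue_poisson`).

Distinct components communicate only through the idle state, which is a bottleneck. While a
component `j` other than that of `i` is active, packets accumulate at `i`, and this mass can only
flow out through the edges joining the component to the idle state, of total conductance at most the
sum `s` of the `nu` over `j`. With `W` the weight of that component and `π` the idle probability,
summation by parts and Cauchy–Schwarz (`poisson_bottleneck`) give `lam i * π * W ^ 2 ≤ s * E[L_i]`.
For the component of `i` itself, the mass accumulated on the whole complement must pass from the
idle state into that component, which gives the analogue with the weight of the complement
(`queue_bottleneck`).

Stability forces the rates to be large: `lam i` is at most the probability that `i` is active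
(`lam_le_activity`), and nodes of distinct components are never active together, so `i` is blocked
with probability at least `rho`. Hence `rho < 1` and `nu i ≥ lam i / (1 - rho)` (`load_bound`). The
fully active state makes `W / s` at least of order `nu ^ (size - 1)`, whence the power of `1 / (1 -
rho)`. Part (1) applies the bottleneck to a component of maximal size, part (2) to the component of
the node itself. Both arguments give twice the stated bound as a weak inequality; positivity of
`E[L_i]` then makes it strict. -/

namespace RandomAccess

/-! ### Weak form of the global balance equations. -/

section Dynamics

section Balance

/-- Weak form of the global balance equations for a chain on a product space whose transitions
move the second coordinate by one of finitely many deterministic maps. -/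
theorem tagged_balance {ι X Y : Type*} [Fintype ι] [Fintype X] [DecidableEq Y]
    (κ : ι → X → X → ℝ≥0∞)
    (τ : ι → Y → Y) (q : X × Y → X × Y → ℝ)
    (hq : ∀ x y, ENNReal.ofReal (q x y) =
      ∑ a, if y.2 = τ a x.2 then κ a x.1 y.1 else 0)
    (p : PMF (X × Y)) (hp : IsStationary q p) (φ : Y → ℝ≥0∞) (u : X) :
    (∑' l, p (u, l) * φ l) * ∑ a, ∑ v, κ a u v
      = ∑ a, ∑ v, κ a v u * ∑' l, p (v, l) * φ (τ a l) := by
  have hout : ∀ l, ∑' y, ENNReal.ofReal (q (u, l) y) = ∑ a, ∑ v, κ a u v := by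
    intro l
    simp only [hq]
    rw [Summable.tsum_finsetSum (fun _ _ => ENNReal.summable)]
    refine Finset.sum_congr rfl fun a _ => ?_
    rw [ENNReal.tsum_prod', tsum_fintype]
    simp
  have hin : ∀ l, p (u, l) * ∑ a, ∑ v, κ a u v
      = ∑ a, ∑ v, ∑' l', if l = τ a l' then p (v, l') * κ a v u else 0 := by
    intro l
    rw [← hout l, hp (u, l)]
    simp only [hq, Finset.mul_sum]
    rw [Summable.tsum_finsetSum (fun _ _ => ENNReal.summable)]
    refine Finset.sum_congr rfl fun a _ => ?_
    rw [ENNReal.tsum_prod', tsum_fintype]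
    simp
  calc (∑' l, p (u, l) * φ l) * ∑ a, ∑ v, κ a u v
      = ∑' l, φ l * (p (u, l) * ∑ a, ∑ v, κ a u v) := by
        rw [← ENNReal.tsum_mul_right]
        exact tsum_congr fun l => by ring
    _ = ∑ a, ∑ v, ∑' l, ∑' l', if l = τ a l' then φ l * (p (v, l') * κ a v u) else 0 := by
        simp only [hin, Finset.mul_sum, ← ENNReal.tsum_mul_left, mul_ite, mul_zero]
        rw [Summable.tsum_finsetSum (fun _ _ => ENNReal.summable)]
        refine Finset.sum_congr rfl fun a _ => ?_
        rw [Summable.tsum_finsetSum (fun _ _ => ENNReal.summable)]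
    _ = _ := by
        refine Finset.sum_congr rfl fun a _ => Finset.sum_congr rfl fun v _ => ?_
        -- Tonelli: summing over the target `l` first, the indicator leaves only `l = τ a l'`.
        rw [ENNReal.tsum_comm, ← ENNReal.tsum_mul_left]
        refine tsum_congr fun l' => ?_
        rw [tsum_ite_eq]
        ring

end Balance

variable {V : Type*} [DecidableEq V] {G : SimpleGraph V}

instance [Fintype V] : Fintype (Activity G) := Fintype.ofFinite _

/-- Node `i` may activate in `u`, which leads to `v`. -/
def Link (i : V) (u v : Activity G) : Prop := Unblocked G u.1 i ∧ v.1 = insert i u.1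

/-- Independence of `v` makes `i` unblocked once it is removed, so de-activations are exactly the
reversed activations; one relation `Link` serves both. -/
theorem link_iff_erase (i : V) (u v : Activity G) :
    Link i u v ↔ i ∈ v.1 ∧ u.1 = v.1.erase i := by
  constructor
  · rintro ⟨h, h'⟩
    refine ⟨by simp [h'], ?_⟩
    rw [h', Finset.erase_insert h.1]
  · rintro ⟨h, h'⟩
    refine ⟨⟨by simp [h'], fun j hj hju => ?_⟩, by rw [h', Finset.insert_erase h]⟩
    have : j ∈ v.1 := Finset.mem_of_mem_erase (h' ▸ hju)
    exact v.2 (Finset.mem_coe.2 h) (Finset.mem_coe.2 this) hj.ne hj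

open Classical in
/-- The indicator of `Link`. -/
def link (i : V) (u v : Activity G) : ℝ := if Link i u v then 1 else 0

theorem link_nonneg (i : V) (u v : Activity G) : 0 ≤ link i u v := by
  unfold link; split_ifs <;> norm_num

theorem link_eq_one {i : V} {u v : Activity G} (h : Link i u v) : link i u v = 1 := if_pos h

theorem link_eq_zero {i : V} {u v : Activity G} (h : ¬ Link i u v) : link i u v = 0 := if_neg h

/-- The `φ`-weighted mass `E[φ(L); U = u]`. -/
def mass (p : PMF (State G)) (φ : (V → ℕ) → ℝ≥0∞) (u : Activity G) : ℝ≥0∞ :=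
  ∑' l, p (u, l) * φ l

variable [Fintype V]

open Classical in
theorem ofReal_fixedRate (lam nu : V → ℝ) (hlam : ∀ i, 0 ≤ lam i) (hnu : ∀ i, 0 < nu i)
    (x y : State G) :
    ENNReal.ofReal (fixedRate G lam nu x y) =
      ∑ i, ((if y.2 = arrive x.2 i then if x.1 = y.1 then ENNReal.ofReal (lam i) else 0 else 0)
        + (if y.2 = x.2 then ENNReal.ofReal (link i x.1 y.1 * nu i) else 0)
        + (if y.2 = depart x.2 i then ENNReal.ofReal (link i y.1 x.1) else 0)) := by
  unfold fixedRate rate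
  rw [ENNReal.ofReal_sum_of_nonneg]
  · refine Finset.sum_congr rfl fun i _ => ?_
    have e1 : (Unblocked G x.1.1 i ∧ y.1.1 = insert i x.1.1 ∧ y.2 = x.2) ↔
        (y.2 = x.2 ∧ Link i x.1 y.1) := by unfold Link; tauto
    have e2 : (i ∈ x.1.1 ∧ y.1.1 = x.1.1.erase i ∧ y.2 = depart x.2 i) ↔
        (y.2 = depart x.2 i ∧ Link i y.1 x.1) := by rw [link_iff_erase]; tauto
    have e3 : (y.1.1 = x.1.1 ∧ y.2 = arrive x.2 i) ↔ (y.2 = arrive x.2 i ∧ x.1 = y.1) := by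
      rw [Subtype.ext_iff]; tauto
    simp only [e1, e2, e3, sub_self, ite_self, add_zero]
    rw [ENNReal.ofReal_add, ENNReal.ofReal_add]
    · congr 1
      · congr 1
        · split_ifs <;> simp_all
        · unfold link; split_ifs <;> simp_all
      · unfold link; split_ifs <;> simp_all
    all_goals
      have := hlam i
      have := (hnu i).le
      positivity
  · intro i _
    have := hlam i
    have := (hnu i).le
    simp only [sub_self, ite_self, add_zero]
    refine add_nonneg (add_nonneg ?_ ?_) ?_ <;> split_ifs <;> positivity

open Classical in
/-- Weak form of the balance equations of the random-access network. -/
theorem mass_balance (lam nu : V → ℝ) (hlam : ∀ i, 0 ≤ lam i) (hnu : ∀ i, 0 < nu i)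
    (p : PMF (State G)) (hp : IsStationary (fixedRate G lam nu) p) (φ : (V → ℕ) → ℝ≥0∞)
    (u : Activity G) :
    mass p φ u * (∑ i, ENNReal.ofReal (lam i)
        + (∑ i, ∑ v, ENNReal.ofReal (link i u v * nu i)
        + ∑ i, ∑ v, ENNReal.ofReal (link i v u)))
      = ∑ i, ENNReal.ofReal (lam i) * mass p (fun l => φ (arrive l i)) u
        + (∑ i, ∑ v, ENNReal.ofReal (link i v u * nu i) * mass p φ v
        + ∑ i, ∑ v, ENNReal.ofReal (link i u v) * mass p (fun l => φ (depart l i)) v) := by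
  -- The three summands of `V ⊕ V ⊕ V` index arrivals, activations and departures.
  have hq : ∀ x y : State G, ENNReal.ofReal (fixedRate G lam nu x y) = ∑ a : V ⊕ V ⊕ V,
      if y.2 = (Sum.elim (fun i l => arrive l i) (Sum.elim (fun _ l => l) (fun i l => depart l i)) :
          V ⊕ V ⊕ V → (V → ℕ) → (V → ℕ)) a x.2 then
        (Sum.elim (fun i u v => if u = v then ENNReal.ofReal (lam i) else 0)
          (Sum.elim (fun i u v => ENNReal.ofReal (link i u v * nu i))
            (fun i u v => ENNReal.ofReal (link i v u))) :
          V ⊕ V ⊕ V → Activity G → Activity G → ℝ≥0∞) a x.1 y.1 else 0 := by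
    intro x y
    rw [ofReal_fixedRate lam nu hlam hnu]
    simp only [Fintype.sum_sum_type, Sum.elim_inl, Sum.elim_inr, Finset.sum_add_distrib,
      add_assoc]
    refine congrArg₂ _ (Finset.sum_congr rfl fun i _ => ?_) (congrArg₂ _
      (Finset.sum_congr rfl fun i _ => ?_) (Finset.sum_congr rfl fun i _ => ?_))
    · exact ite_congr rfl (fun _ => rfl) (fun _ => rfl)
    · exact ite_congr rfl (fun _ => rfl) (fun _ => rfl)
    · exact ite_congr rfl (fun _ => rfl) (fun _ => rfl)
  have := tagged_balance _ _ _ hq p hp φ u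
  simpa only [mass, Fintype.sum_sum_type, Sum.elim_inl, Sum.elim_inr, Finset.sum_ite_eq,
    Finset.sum_ite_eq', Finset.mem_univ, if_true, ite_mul, zero_mul] using this

end Dynamics

/-! ### Potential theory on finite weighted graphs. -/

section Conductance

theorem sum_antisymm_eq_zero {X : Type*} (a : X → X → ℝ) (hs : ∀ u v, a u v = a v u)
    (C : Finset X) (h : X → ℝ) : ∑ u ∈ C, ∑ v ∈ C, a u v * (h u - h v) = 0 := by
  have : ∑ u ∈ C, ∑ v ∈ C, a u v * (h u - h v) = -∑ u ∈ C, ∑ v ∈ C, a u v * (h u - h v) := by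
    conv_lhs => rw [Finset.sum_comm]
    simp only [← Finset.sum_neg_distrib]
    refine Finset.sum_congr rfl fun u _ => Finset.sum_congr rfl fun v _ => ?_
    rw [hs v u]; ring
  linarith

/-- Summation by parts: the Dirichlet form. -/
theorem two_mul_sum_eq_energy {X : Type*} (a : X → X → ℝ) (hs : ∀ u v, a u v = a v u)
    (C : Finset X) (h : X → ℝ) :
    2 * ∑ u ∈ C, h u * ∑ v ∈ C, a u v * (h u - h v)
      = ∑ u ∈ C, ∑ v ∈ C, a u v * (h u - h v) ^ 2 := by
  have key : ∑ u ∈ C, h u * ∑ v ∈ C, a u v * (h u - h v)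
      = ∑ u ∈ C, ∑ v ∈ C, a u v * (h v * (h v - h u)) := by
    rw [Finset.sum_comm]
    refine Finset.sum_congr rfl fun u _ => ?_
    rw [Finset.mul_sum]
    refine Finset.sum_congr rfl fun v _ => ?_
    rw [hs v u]; ring
  rw [two_mul]
  nth_rewrite 2 [key]
  rw [← Finset.sum_add_distrib]
  refine Finset.sum_congr rfl fun u _ => ?_
  rw [Finset.mul_sum, ← Finset.sum_add_distrib]
  refine Finset.sum_congr rfl fun v _ => ?_
  ring

/-- A harmonic function on a finite weighted graph is constant along edges. -/
theorem eq_of_harmonic {X : Type*} [Fintype X] (a : X → X → ℝ) (hs : ∀ u v, a u v = a v u)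
    (ha : ∀ u v, 0 ≤ a u v) (r : X → ℝ) (h : ∀ u, ∑ v, a u v * (r u - r v) = 0)
    {u v : X} (huv : 0 < a u v) : r u = r v := by
  have h0 := two_mul_sum_eq_energy a hs Finset.univ r
  simp only [h, mul_zero, Finset.sum_const_zero] at h0
  have h1 := (Finset.sum_eq_zero_iff_of_nonneg (fun u _ => Finset.sum_nonneg fun v _ =>
    mul_nonneg (ha u v) (sq_nonneg _))).1 h0.symm u (Finset.mem_univ _)
  have h2 := (Finset.sum_eq_zero_iff_of_nonneg (fun v _ =>
    mul_nonneg (ha u v) (sq_nonneg _))).1 h1 v (Finset.mem_univ _)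
  have h3 : (r u - r v) ^ 2 = 0 := by
    rcases mul_eq_zero.1 h2 with h | h
    · exact absurd h huv.ne'
    · exact h
  have := pow_eq_zero_iff (two_ne_zero) |>.1 h3
  linarith

/-- A set `C` attached to the rest of a weighted graph only through the vertex `o`: the flux into
`o` of a solution of the Poisson equation on `C`, and the bottleneck bound for its mean. -/
theorem poisson_bottleneck {X : Type*} [Fintype X] (a : X → X → ℝ) (hs : ∀ u v, a u v = a v u)
    (ha : ∀ u v, 0 ≤ a u v) (C : Finset X) (o : X) (ho : o ∉ C)
    (hC : ∀ u ∈ C, ∀ v, v ∉ C → v ≠ o → a u v = 0) (g μ : X → ℝ) (c : ℝ) (hc : 0 < c)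
    (h : ∀ u ∈ C, ∑ v, a u v * (g u - g v) = c * μ u) :
    ∑ u ∈ C, a o u * (g u - g o) = c * ∑ u ∈ C, μ u ∧
    c * (∑ u ∈ C, μ u) ^ 2 ≤ (∑ u ∈ C, a o u) * ∑ u ∈ C, μ u * (g u - g o) := by
  classical
  set k : X → ℝ := fun u => g u - g o with hk
  -- `k` is grounded at `o`, so the Laplacian on `C` is its internal part plus a killing term.
  have split : ∀ u ∈ C, (∑ v ∈ C, a u v * (k u - k v)) + a o u * k u = c * μ u := by
    intro u hu
    rw [← h u hu, ← Finset.sum_subset (Finset.subset_univ (insert o C))]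
    · rw [Finset.sum_insert ho, add_comm, hs o u]
      simp [hk]
    · intro v _ hv
      rw [Finset.mem_insert, not_or] at hv
      rw [hC u hu v hv.2 hv.1, zero_mul]
  have flux : ∑ u ∈ C, a o u * k u = c * ∑ u ∈ C, μ u := by
    rw [Finset.mul_sum, ← Finset.sum_congr rfl split, Finset.sum_add_distrib,
      sum_antisymm_eq_zero a hs, zero_add]
  refine ⟨flux, ?_⟩
  have energy : ∑ u ∈ C, a o u * k u ^ 2 ≤ c * ∑ u ∈ C, μ u * k u := by
    have e1 : c * ∑ u ∈ C, μ u * k u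
        = (∑ u ∈ C, k u * ∑ v ∈ C, a u v * (k u - k v)) + ∑ u ∈ C, a o u * k u ^ 2 := by
      rw [Finset.mul_sum, ← Finset.sum_add_distrib]
      refine Finset.sum_congr rfl fun u hu => ?_
      rw [← mul_assoc, ← split u hu]; ring
    have e2 := two_mul_sum_eq_energy a hs C k
    have e3 : 0 ≤ ∑ u ∈ C, ∑ v ∈ C, a u v * (k u - k v) ^ 2 :=
      Finset.sum_nonneg fun u _ => Finset.sum_nonneg fun v _ => mul_nonneg (ha u v) (sq_nonneg _)
    linarith
  -- Cauchy–Schwarz on the edges at `o`; the internal energy has been discarded.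
  have cs : (∑ u ∈ C, a o u * k u) ^ 2 ≤ (∑ u ∈ C, a o u) * ∑ u ∈ C, a o u * k u ^ 2 := by
    refine Finset.sum_sq_le_sum_mul_sum_of_sq_le_mul C (fun u _ => ha o u)
      (fun u _ => mul_nonneg (ha o u) (sq_nonneg _)) (fun u _ => le_of_eq (by ring))
  rw [flux] at cs
  have e4 : (∑ u ∈ C, a o u) * ∑ u ∈ C, a o u * k u ^ 2
      ≤ (∑ u ∈ C, a o u) * (c * ∑ u ∈ C, μ u * k u) :=
    mul_le_mul_of_nonneg_left energy (Finset.sum_nonneg fun u _ => ha o u)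
  refine le_of_mul_le_mul_left ?_ hc
  calc c * (c * (∑ u ∈ C, μ u) ^ 2) = (c * ∑ u ∈ C, μ u) ^ 2 := by ring
    _ ≤ _ := cs.trans e4
    _ = _ := by ring

end Conductance

/-! ### Test functions of one queue, and the activity needed to carry the load. -/

section Tests

variable {V : Type*} [DecidableEq V] [Fintype V] {G : SimpleGraph V}

/-- The real number `E[ψ(L_i); U = u]`. -/
def qmass (p : PMF (State G)) (i : V) (ψ : ℕ → ℝ≥0∞) (u : Activity G) : ℝ :=
  (mass p (fun l => ψ (l i)) u).toReal

/-- The probability `P(U = u)`. -/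
def prob (p : PMF (State G)) (u : Activity G) : ℝ := (mass p (fun _ => 1) u).toReal

theorem qmass_nonneg (p : PMF (State G)) (i : V) (ψ : ℕ → ℝ≥0∞) (u : Activity G) :
    0 ≤ qmass p i ψ u := ENNReal.toReal_nonneg

theorem prob_nonneg (p : PMF (State G)) (u : Activity G) : 0 ≤ prob p u := ENNReal.toReal_nonneg

theorem sum_mass (p : PMF (State G)) (φ : (V → ℕ) → ℝ≥0∞) :
    ∑ u, mass p φ u = ∑' x : State G, p x * φ x.2 := by
  rw [ENNReal.tsum_prod', tsum_fintype]; rfl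

theorem sum_mass_one (p : PMF (State G)) : ∑ u, mass p (fun _ => 1) u = 1 := by
  rw [sum_mass]; simp [p.tsum_coe]

theorem mass_one_ne_top (p : PMF (State G)) (u : Activity G) : mass p (fun _ => 1) u ≠ ⊤ := by
  refine ne_top_of_le_ne_top ENNReal.one_ne_top ?_
  exact (Finset.single_le_sum (f := fun u => mass p (fun _ => 1) u) (fun _ _ => zero_le)
    (Finset.mem_univ u)).trans_eq (sum_mass_one p)

theorem mass_mono (p : PMF (State G)) {φ φ' : (V → ℕ) → ℝ≥0∞} (h : ∀ l, φ l ≤ φ' l)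
    (u : Activity G) : mass p φ u ≤ mass p φ' u :=
  ENNReal.tsum_le_tsum fun l => mul_le_mul_right (h l) _

theorem mass_add (p : PMF (State G)) (φ φ' : (V → ℕ) → ℝ≥0∞) (u : Activity G) :
    mass p (fun l => φ l + φ' l) u = mass p φ u + mass p φ' u := by
  simp only [mass, mul_add, ENNReal.tsum_add]

theorem mass_const (p : PMF (State G)) (c : ℝ≥0∞) (u : Activity G) :
    mass p (fun _ => c) u = mass p (fun _ => 1) u * c := by
  simp only [mass, mul_one, ENNReal.tsum_mul_right]

theorem sum_prob (p : PMF (State G)) : ∑ u, prob p u = 1 := by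
  unfold prob
  rw [← ENNReal.toReal_sum fun u _ => mass_one_ne_top p u, sum_mass_one, ENNReal.toReal_one]

/-- Balance equations tested against a function of the queue length of one node. -/
theorem qmass_balance (lam nu : V → ℝ) (hlam : ∀ i, 0 ≤ lam i) (hnu : ∀ i, 0 < nu i)
    (p : PMF (State G)) (hp : IsStationary (fixedRate G lam nu) p) (i : V) (ψ : ℕ → ℝ≥0∞)
    (h0 : ∀ u, mass p (fun l => ψ (l i)) u ≠ ⊤)
    (h1 : ∀ u, mass p (fun l => ψ (l i + 1)) u ≠ ⊤)
    (h2 : ∀ u, mass p (fun l => ψ (l i - 1)) u ≠ ⊤) (u : Activity G) :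
    qmass p i ψ u * ((∑ j, ∑ v, link j u v * nu j) + ∑ j, ∑ v, link j v u)
      = lam i * (qmass p i (fun n => ψ (n + 1)) u - qmass p i ψ u)
        + (∑ j, ∑ v, link j v u * nu j * qmass p i ψ v + ∑ j, ∑ v, link j u v * qmass p i ψ v)
        + ∑ v, link i u v * (qmass p i (fun n => ψ (n - 1)) v - qmass p i ψ v) := by
  have harr : ∀ j, mass p (fun l => ψ (arrive l j i)) u
      = if j = i then mass p (fun l => ψ (l i + 1)) u else mass p (fun l => ψ (l i)) u := by
    intro j
    split_ifs with h
    · subst h; simp [arrive]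
    · simp [arrive, Function.update_of_ne (Ne.symm h)]
  have hdep : ∀ j v, mass p (fun l => ψ (depart l j i)) v
      = if j = i then mass p (fun l => ψ (l i - 1)) v else mass p (fun l => ψ (l i)) v := by
    intro j v
    split_ifs with h
    · subst h; simp [depart]
    · simp [depart, Function.update_of_ne (Ne.symm h)]
  have H := congrArg ENNReal.toReal (mass_balance lam nu hlam hnu p hp (fun l => ψ (l i)) u)
  have hln : ∀ j (v w : Activity G), 0 ≤ link j v w * nu j := fun j v w =>
    mul_nonneg (link_nonneg _ _ _) (hnu j).le
  have T1 : ∀ j, ENNReal.ofReal (lam j) * mass p (fun l => ψ (arrive l j i)) u ≠ ⊤ := fun j =>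
    ENNReal.mul_ne_top ENNReal.ofReal_ne_top (by rw [harr]; split_ifs; exacts [h1 u, h0 u])
  have T2 : ∀ j v, ENNReal.ofReal (link j v u * nu j) * mass p (fun l => ψ (l i)) v ≠ ⊤ :=
    fun j v => ENNReal.mul_ne_top ENNReal.ofReal_ne_top (h0 v)
  have T3 : ∀ j v, ENNReal.ofReal (link j u v) * mass p (fun l => ψ (depart l j i)) v ≠ ⊤ :=
    fun j v => ENNReal.mul_ne_top ENNReal.ofReal_ne_top
      (by rw [hdep]; split_ifs; exacts [h2 v, h0 v])
  have S2 : ∀ j, ∑ v, ENNReal.ofReal (link j v u * nu j) * mass p (fun l => ψ (l i)) v ≠ ⊤ :=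
    fun j => ENNReal.sum_ne_top.2 fun v _ => T2 j v
  have S3 : ∀ j, ∑ v, ENNReal.ofReal (link j u v) * mass p (fun l => ψ (depart l j i)) v ≠ ⊤ :=
    fun j => ENNReal.sum_ne_top.2 fun v _ => T3 j v
  have U1 : ∀ j, ∑ v, ENNReal.ofReal (link j u v * nu j) ≠ ⊤ :=
    fun j => ENNReal.sum_ne_top.2 fun v _ => ENNReal.ofReal_ne_top
  have U2 : ∀ j, ∑ v, ENNReal.ofReal (link j v u) ≠ ⊤ :=
    fun j => ENNReal.sum_ne_top.2 fun v _ => ENNReal.ofReal_ne_top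
  rw [ENNReal.toReal_mul, ENNReal.toReal_add (ENNReal.sum_ne_top.2 fun _ _ => ENNReal.ofReal_ne_top)
      (ENNReal.add_ne_top.2 ⟨ENNReal.sum_ne_top.2 fun j _ => U1 j,
        ENNReal.sum_ne_top.2 fun j _ => U2 j⟩),
    ENNReal.toReal_add (ENNReal.sum_ne_top.2 fun j _ => U1 j)
      (ENNReal.sum_ne_top.2 fun j _ => U2 j),
    ENNReal.toReal_add (ENNReal.sum_ne_top.2 fun j _ => T1 j)
      (ENNReal.add_ne_top.2 ⟨ENNReal.sum_ne_top.2 fun j _ => S2 j,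
        ENNReal.sum_ne_top.2 fun j _ => S3 j⟩),
    ENNReal.toReal_add (ENNReal.sum_ne_top.2 fun j _ => S2 j)
      (ENNReal.sum_ne_top.2 fun j _ => S3 j),
    ENNReal.toReal_sum (fun _ _ => ENNReal.ofReal_ne_top), ENNReal.toReal_sum (fun j _ => U1 j),
    ENNReal.toReal_sum (fun j _ => U2 j), ENNReal.toReal_sum (fun j _ => T1 j),
    ENNReal.toReal_sum (fun j _ => S2 j), ENNReal.toReal_sum (fun j _ => S3 j)] at H
  simp only [ENNReal.toReal_sum fun v _ => ENNReal.ofReal_ne_top,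
    ENNReal.toReal_sum fun v _ => T2 _ v, ENNReal.toReal_sum fun v _ => T3 _ v] at H
  simp only [ENNReal.toReal_mul, ENNReal.toReal_ofReal (hlam _), ENNReal.toReal_ofReal (hln _ _ _),
    ENNReal.toReal_ofReal (link_nonneg _ _ _), harr, hdep] at H
  -- Events at other nodes leave `L_i` unchanged, so only `j = i` gives an increment; the total
  -- arrival rate cancels against the outflow.
  have E1 : ∑ j, lam j * (if j = i then mass p (fun l => ψ (l i + 1)) u
      else mass p (fun l => ψ (l i)) u).toReal
      = (∑ j, lam j) * qmass p i ψ u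
        + lam i * (qmass p i (fun n => ψ (n + 1)) u - qmass p i ψ u) := by
    have : ∀ j, lam j * (if j = i then mass p (fun l => ψ (l i + 1)) u
      else mass p (fun l => ψ (l i)) u).toReal = lam j * qmass p i ψ u
        + if j = i then lam i * (qmass p i (fun n => ψ (n + 1)) u - qmass p i ψ u) else 0 := by
      intro j
      split_ifs with h
      · subst h; unfold qmass; ring
      · unfold qmass; ring
    rw [Finset.sum_congr rfl fun j _ => this j, Finset.sum_add_distrib, Finset.sum_mul]
    simp
  have E2 : ∑ j, ∑ v, link j u v * (if j = i then mass p (fun l => ψ (l i - 1)) v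
      else mass p (fun l => ψ (l i)) v).toReal
      = (∑ j, ∑ v, link j u v * qmass p i ψ v)
        + ∑ v, link i u v * (qmass p i (fun n => ψ (n - 1)) v - qmass p i ψ v) := by
    have : ∀ j, ∑ v, link j u v * (if j = i then mass p (fun l => ψ (l i - 1)) v
      else mass p (fun l => ψ (l i)) v).toReal = (∑ v, link j u v * qmass p i ψ v)
        + if j = i then ∑ v, link i u v * (qmass p i (fun n => ψ (n - 1)) v - qmass p i ψ v)
          else 0 := by
      intro j
      split_ifs with h
      · subst h
        rw [← Finset.sum_add_distrib]
        refine Finset.sum_congr rfl fun v _ => ?_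
        unfold qmass; ring
      · unfold qmass; ring
    rw [Finset.sum_congr rfl fun j _ => this j, Finset.sum_add_distrib]
    simp
  rw [E1, E2] at H
  have H' : (mass p (fun l => ψ (l i)) u).toReal = qmass p i ψ u := rfl
  have H'' : ∀ v, (mass p (fun l => ψ (l i)) v).toReal = qmass p i ψ v := fun _ => rfl
  simp only [H''] at H
  linear_combination H

theorem sum_link_mul_le (i : V) (u : Activity G) (f : ℝ) (hf : 0 ≤ f) :
    ∑ v, link i u v * f ≤ open Classical in if Unblocked G u.1 i then f else 0 := by
  classical
  split_ifs with h
  · by_cases hv : ∃ v, Link i u v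
    · obtain ⟨v, hv⟩ := hv
      rw [Finset.sum_eq_single v]
      · rw [link_eq_one hv, one_mul]
      · intro w _ hw
        rw [link_eq_zero, zero_mul]
        exact fun hw' => hw (Subtype.ext (hw'.2.trans hv.2.symm))
      · simp
    · rw [Finset.sum_eq_zero]
      · exact hf
      · intro v _
        rw [link_eq_zero fun h => hv ⟨v, h⟩, zero_mul]
  · rw [Finset.sum_eq_zero]
    intro v _
    rw [link_eq_zero fun h' => h h'.1, zero_mul]

theorem sum_link_mul_le' (i : V) (v : Activity G) (f : ℝ) (hf : 0 ≤ f) :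
    ∑ u, link i u v * f ≤ if i ∈ v.1 then f else 0 := by
  split_ifs with h
  · by_cases hu : ∃ u, Link i u v
    · obtain ⟨u, hu⟩ := hu
      rw [Finset.sum_eq_single u]
      · rw [link_eq_one hu, one_mul]
      · intro w _ hw
        rw [link_eq_zero, zero_mul]
        rw [link_iff_erase] at hu ⊢
        exact fun hw' => hw (Subtype.ext (hw'.2.trans hu.2.symm))
      · simp
    · rw [Finset.sum_eq_zero]
      · exact hf
      · intro u _
        rw [link_eq_zero fun h => hu ⟨u, h⟩, zero_mul]
  · rw [Finset.sum_eq_zero]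
    intro u _
    rw [link_eq_zero, zero_mul]
    rw [link_iff_erase]
    exact fun h' => h h'.1

/-- In a stationary system the arrival rate at a node is at most its probability of being
active. -/
theorem lam_le_activity (lam nu : V → ℝ) (hlam : ∀ i, 0 ≤ lam i) (hnu : ∀ i, 0 < nu i)
    (p : PMF (State G)) (hp : IsStationary (fixedRate G lam nu) p) (i : V) :
    lam i ≤ ∑ u, ∑ v, link i u v * prob p v := by
  set θ := ∑ u, ∑ v, link i u v * prob p v with hθ
  have hθ0 : 0 ≤ θ := Finset.sum_nonneg fun u _ => Finset.sum_nonneg fun v _ =>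
    mul_nonneg (link_nonneg _ _ _) (prob_nonneg _ _)
  have key : ∀ N : ℕ, lam i * ∑ u, qmass p i (fun n => if n < N then 1 else 0) u ≤ θ := by
    intro N
    -- Truncation at `N`, since `E[L_i]` may be infinite. An arrival increases `ψ` exactly when `L_i
    -- < N`, and a departure decreases it by at most one.
    set ψ : ℕ → ℝ≥0∞ := fun n => (min n N : ℕ) with hψ
    have fin : ∀ (τ : ℕ → ℕ) u, mass p (fun l => ψ (τ (l i))) u ≠ ⊤ := fun τ u =>
      ne_top_of_le_ne_top (by
        rw [mass_const]
        exact ENNReal.mul_ne_top (mass_one_ne_top p u) (ENNReal.natCast_ne_top N))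
        (mass_mono p (φ' := fun _ => (N : ℝ≥0∞))
          (fun l => by simp only [hψ]; exact_mod_cast min_le_right _ _) u)
    have bal := fun u => qmass_balance lam nu hlam hnu p hp i ψ (fin fun n => n)
      (fin fun n => n + 1) (fin fun n => n - 1) u
    have e1 : ∀ u, qmass p i (fun n => ψ (n + 1)) u - qmass p i ψ u
        = qmass p i (fun n => if n < N then 1 else 0) u := by
      intro u
      have : mass p (fun l => ψ (l i + 1)) u
          = mass p (fun l => ψ (l i)) u + mass p (fun l => if l i < N then 1 else 0) u := by
        rw [← mass_add]
        congr 1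
        funext l
        simp only [hψ]
        split_ifs with h
        · rw [min_eq_left (by omega), min_eq_left (by omega)]; push_cast; rfl
        · rw [min_eq_right (by omega), min_eq_right (by omega)]; simp
      unfold qmass
      rw [this, ENNReal.toReal_add (fin (fun n => n) u)
        (ne_top_of_le_ne_top (fin (fun n => n + 1) u) (this ▸ le_add_self))]
      ring
    have e2 : ∀ v, qmass p i ψ v - qmass p i (fun n => ψ (n - 1)) v ≤ prob p v := by
      intro v
      have : mass p (fun l => ψ (l i)) v
          ≤ mass p (fun l => ψ (l i - 1)) v + mass p (fun _ => 1) v := by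
        rw [← mass_add]
        refine mass_mono p (fun l => ?_) v
        simp only [hψ]
        exact_mod_cast (by omega : min (l i) N ≤ min (l i - 1) N + 1)
      have h := ENNReal.toReal_mono (ENNReal.add_ne_top.2
        ⟨fin (fun n => n - 1) v, mass_one_ne_top p v⟩) this
      rw [ENNReal.toReal_add (fin (fun n => n - 1) v) (mass_one_ne_top p v)] at h
      unfold qmass prob
      linarith
    -- Summed over all activity states, inflow and outflow of the activity process cancel.
    have s1 : ∑ u, ∑ j, ∑ v, link j v u * nu j * qmass p i ψ v
        = ∑ u, qmass p i ψ u * ∑ j, ∑ v, link j u v * nu j := by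
      simp only [Finset.mul_sum]
      rw [Finset.sum_comm]
      conv_rhs => rw [Finset.sum_comm]
      refine Finset.sum_congr rfl fun j _ => ?_
      rw [Finset.sum_comm]
      refine Finset.sum_congr rfl fun u _ => Finset.sum_congr rfl fun v _ => by ring
    have s2 : ∑ u, ∑ j, ∑ v, link j u v * qmass p i ψ v
        = ∑ u, qmass p i ψ u * ∑ j, ∑ v, link j v u := by
      simp only [Finset.mul_sum]
      rw [Finset.sum_comm]
      conv_rhs => rw [Finset.sum_comm]
      refine Finset.sum_congr rfl fun j _ => ?_
      rw [Finset.sum_comm]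
      refine Finset.sum_congr rfl fun u _ => Finset.sum_congr rfl fun v _ => by ring
    have tot := Finset.sum_congr rfl fun u (_ : u ∈ Finset.univ) => bal u
    simp only [Finset.sum_add_distrib, mul_add, e1] at tot
    rw [s1, s2, ← Finset.mul_sum] at tot
    have s3 : -∑ u, ∑ v, link i u v * (qmass p i (fun n => ψ (n - 1)) v - qmass p i ψ v) ≤ θ := by
      rw [hθ, ← Finset.sum_neg_distrib]
      refine Finset.sum_le_sum fun u _ => ?_
      rw [← Finset.sum_neg_distrib]
      refine Finset.sum_le_sum fun v _ => ?_
      have := mul_le_mul_of_nonneg_left (e2 v) (link_nonneg i u v)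
      linarith
    linarith
  by_contra! hlt
  have hl : 0 < lam i := hθ0.trans_lt hlt
  -- If `lam i > θ`, some finite set of states already has mass above `θ / lam i`; taking `N` above
  -- its queue lengths contradicts `key`.
  have h1 : ENNReal.ofReal (θ / lam i) < ∑' x, p x := by
    rw [p.tsum_coe, ← ENNReal.ofReal_one]
    exact (ENNReal.ofReal_lt_ofReal_iff one_pos).2 ((div_lt_one hl).2 hlt)
  rw [ENNReal.tsum_eq_iSup_sum, lt_iSup_iff] at h1
  obtain ⟨s, hs⟩ := h1
  have hN : ∀ x ∈ s, x.2 i < s.sup (fun x => x.2 i) + 1 := fun x hx =>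
    Nat.lt_succ_of_le (Finset.le_sup (f := fun x : State G => x.2 i) hx)
  have h2 := key (s.sup (fun x => x.2 i) + 1)
  generalize s.sup (fun x => x.2 i) + 1 = N at hN h2
  have hfin : ∀ u, mass p (fun l => if l i < N then 1 else 0) u ≠ ⊤ := fun u =>
    ne_top_of_le_ne_top (mass_one_ne_top p u)
      (mass_mono p (fun l => by split_ifs <;> simp) u)
  have h3 : ENNReal.ofReal (∑ u, qmass p i (fun n => if n < N then 1 else 0) u)
      = ∑ u, mass p (fun l => if l i < N then 1 else 0) u := by
    rw [ENNReal.ofReal_sum_of_nonneg fun u _ => qmass_nonneg _ _ _ _]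
    exact Finset.sum_congr rfl fun u _ => ENNReal.ofReal_toReal (hfin u)
  have h4 : ∑ x ∈ s, p x ≤ ENNReal.ofReal (∑ u, qmass p i (fun n => if n < N then 1 else 0) u) := by
    rw [h3, sum_mass]
    refine le_trans (le_of_eq ?_) (ENNReal.sum_le_tsum s)
    refine Finset.sum_congr rfl fun x hx => ?_
    simp [hN x hx]
  have h5 := lt_of_lt_of_le hs h4
  rw [ENNReal.ofReal_lt_ofReal_iff_of_nonneg (by positivity), div_lt_iff₀ hl] at h5
  linarith

end Tests

/-! ### Reversibility and product form of the activity process. -/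

section Activity

variable {V : Type*} [DecidableEq V] [Fintype V] {G : SimpleGraph V}

/-- The unnormalized product-form weight of an activity state. -/
def weight (nu : V → ℝ) (u : Activity G) : ℝ := ∏ i ∈ u.1, nu i

/-- The conductances of the reversible activity process. -/
def conductance (nu : V → ℝ) (u v : Activity G) : ℝ :=
  ∑ j, (link j u v * weight nu v + link j v u * weight nu u)

/-- The state without active nodes. -/
def idle : Activity G := ⟨∅, by simp [SimpleGraph.IsIndepSet]⟩

theorem weight_pos {nu : V → ℝ} (hnu : ∀ i, 0 < nu i) (u : Activity G) : 0 < weight nu u :=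
  Finset.prod_pos fun i _ => hnu i

theorem weight_idle (nu : V → ℝ) : weight nu (idle : Activity G) = 1 := by
  simp [weight, idle]

theorem weight_of_link (nu : V → ℝ) {i : V} {u v : Activity G} (h : Link i u v) :
    weight nu v = nu i * weight nu u := by
  unfold weight
  rw [h.2, Finset.prod_insert h.1.1]

/-- Detailed balance between de-activation at rate `1` and activation at rate `nu i`. -/
theorem link_mul_weight (nu : V → ℝ) (i : V) (u v : Activity G) :
    link i u v * weight nu v = link i u v * (nu i * weight nu u) := by
  by_cases h : Link i u v
  · rw [weight_of_link nu h]
  · simp [link_eq_zero h]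

theorem conductance_symm (nu : V → ℝ) (u v : Activity G) :
    conductance nu u v = conductance nu v u :=
  Finset.sum_congr rfl fun _ _ => add_comm _ _

theorem conductance_nonneg {nu : V → ℝ} (hnu : ∀ i, 0 < nu i) (u v : Activity G) :
    0 ≤ conductance nu u v :=
  Finset.sum_nonneg fun _ _ => add_nonneg
    (mul_nonneg (link_nonneg _ _ _) (weight_pos hnu _).le)
    (mul_nonneg (link_nonneg _ _ _) (weight_pos hnu _).le)

theorem link_mul_weight_le {nu : V → ℝ} (hnu : ∀ i, 0 < nu i) (i : V) (u v : Activity G) :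
    link i u v * weight nu v ≤ conductance nu u v := by
  refine le_trans ?_ (Finset.single_le_sum (f := fun j =>
    link j u v * weight nu v + link j v u * weight nu u) (fun j _ => ?_) (Finset.mem_univ i))
  · have := mul_nonneg (link_nonneg i v u) (weight_pos hnu u).le
    linarith
  · exact add_nonneg (mul_nonneg (link_nonneg _ _ _) (weight_pos hnu _).le)
      (mul_nonneg (link_nonneg _ _ _) (weight_pos hnu _).le)

theorem conductance_eq_zero (nu : V → ℝ) {u v : Activity G} (h : ∀ j, ¬ Link j u v)
    (h' : ∀ j, ¬ Link j v u) : conductance nu u v = 0 :=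
  Finset.sum_eq_zero fun j _ => by rw [link_eq_zero (h j), link_eq_zero (h' j)]; ring

/-- By detailed balance the net outflow of a mass `f` is the symmetric Laplacian of its density `g`
with respect to `weight`. -/
theorem laplacian_eq (nu : V → ℝ) (f g : Activity G → ℝ) (hfg : ∀ u, f u = weight nu u * g u)
    (u : Activity G) :
    ∑ v, conductance nu u v * (g u - g v)
      = f u * ((∑ j, ∑ v, link j u v * nu j) + ∑ j, ∑ v, link j v u)
        - (∑ j, ∑ v, link j v u * nu j * f v + ∑ j, ∑ v, link j u v * f v) := by
  simp only [conductance, mul_add, Finset.mul_sum, Finset.sum_mul]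
  rw [Finset.sum_comm]
  simp only [← Finset.sum_add_distrib, ← Finset.sum_sub_distrib]
  refine Finset.sum_congr rfl fun j _ => Finset.sum_congr rfl fun v _ => ?_
  rw [hfg u, hfg v]
  linear_combination (g u) * link_mul_weight nu j u v - g v * link_mul_weight nu j v u

/-- The activity process has a product-form distribution. -/
theorem prob_eq_weight (lam nu : V → ℝ) (hlam : ∀ i, 0 ≤ lam i) (hnu : ∀ i, 0 < nu i)
    (p : PMF (State G)) (hp : IsStationary (fixedRate G lam nu) p) (i : V) (u : Activity G) :
    prob p u = prob p idle * weight nu u := by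
  have hharm : ∀ u, ∑ v, conductance nu u v
      * (prob p u / weight nu u - prob p v / weight nu v) = 0 := by
    intro u
    rw [laplacian_eq nu (prob p) (fun u => prob p u / weight nu u)
      (fun u => by rw [mul_div_cancel₀ _ (weight_pos hnu u).ne'])]
    -- The constant is viewed as a function of `L_i`, which is why some node `i` is needed at all.
    have := qmass_balance lam nu hlam hnu p hp i (fun _ => 1) (mass_one_ne_top p)
      (mass_one_ne_top p) (mass_one_ne_top p) u
    have e : ∀ u, qmass p i (fun _ => 1) u = prob p u := fun _ => rfl
    simp only [e, sub_self, mul_zero, Finset.sum_const_zero] at this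
    linarith
  -- The density is harmonic, hence constant along edges, and removing active nodes one by one joins
  -- `u` to the idle state.
  have hconst : ∀ (n : ℕ) (u : Activity G), u.1.card = n →
      prob p u / weight nu u = prob p idle := by
    intro n
    induction n with
    | zero =>
      intro u hu
      have : u = idle := Subtype.ext (Finset.card_eq_zero.1 hu)
      rw [this, weight_idle, div_one]
    | succ n ih =>
      intro u hu
      obtain ⟨j, hj⟩ := Finset.card_pos.1 (by omega : 0 < u.1.card)
      let v : Activity G := ⟨u.1.erase j, u.2.mono (by simp)⟩
      have hlink : Link j v u := (link_iff_erase j v u).2 ⟨hj, rfl⟩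
      have hpos : 0 < conductance nu v u := by
        refine lt_of_lt_of_le ?_ (link_mul_weight_le hnu j v u)
        rw [link_eq_one hlink, one_mul]; exact weight_pos hnu u
      rw [← eq_of_harmonic _ (conductance_symm nu) (conductance_nonneg hnu) _ hharm hpos]
      exact ih v (by simp [v, Finset.card_erase_of_mem hj, hu])
  have := hconst _ u rfl
  rwa [div_eq_iff (weight_pos hnu u).ne'] at this

/-- The Poisson equation for the mean queue length as a function of the activity state. -/
theorem queue_poisson (lam nu : V → ℝ) (hlam : ∀ i, 0 ≤ lam i) (hnu : ∀ i, 0 < nu i)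
    (p : PMF (State G)) (hp : IsStationary (fixedRate G lam nu) p) (i : V)
    (hfin : ∀ u, mass p (fun l => (l i : ℝ≥0∞)) u ≠ ⊤) (u : Activity G) :
    ∑ v, conductance nu u v * (qmass p i (fun n => n) u / weight nu u
        - qmass p i (fun n => n) v / weight nu v)
      = lam i * prob p u + ∑ v, link i u v * (qmass p i (fun n => ((n - 1 : ℕ) : ℝ≥0∞)) v
        - qmass p i (fun n => n) v) := by
  have h1 : ∀ u, mass p (fun l => ((l i + 1 : ℕ) : ℝ≥0∞)) u
      = mass p (fun l => (l i : ℝ≥0∞)) u + mass p (fun _ => 1) u := by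
    intro u; rw [← mass_add]; simp
  have h1' : ∀ u, mass p (fun l => ((l i + 1 : ℕ) : ℝ≥0∞)) u ≠ ⊤ := fun u => by
    rw [h1]; exact ENNReal.add_ne_top.2 ⟨hfin u, mass_one_ne_top p u⟩
  have h2 : ∀ u, mass p (fun l => ((l i - 1 : ℕ) : ℝ≥0∞)) u ≠ ⊤ := fun u =>
    ne_top_of_le_ne_top (hfin u) (mass_mono p (fun l => by exact_mod_cast Nat.sub_le _ _) u)
  have e : qmass p i (fun n => ((n + 1 : ℕ) : ℝ≥0∞)) u - qmass p i (fun n => n) u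
      = prob p u := by
    unfold qmass prob
    rw [h1, ENNReal.toReal_add (hfin u) (mass_one_ne_top p u)]; ring
  rw [laplacian_eq nu (qmass p i (fun n => n)) (fun u => qmass p i (fun n => n) u / weight nu u)
      (fun u => by rw [mul_div_cancel₀ _ (weight_pos hnu u).ne'])]
  have := qmass_balance lam nu hlam hnu p hp i (fun n => (n : ℝ≥0∞)) hfin h1' h2 u
  rw [e] at this
  rw [this]; ring

/-! ### Bottleneck at the idle state of a complete multipartite graph. -/

section Multipartite

variable {K : ℕ}

open Classical in
/-- The activity states in which component `j` is active. -/
def activeIn (c : V → Fin K) (j : Fin K) : Finset (Activity G) :=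
  Finset.univ.filter fun u => ∃ i ∈ u.1, c i = j

theorem mem_activeIn {c : V → Fin K} {j : Fin K} {u : Activity G} :
    u ∈ activeIn c j ↔ ∃ i ∈ u.1, c i = j := by simp [activeIn]

theorem comp_eq_of_mem {c : V → Fin K} (hG : ∀ i j, G.Adj i j ↔ c i ≠ c j) (u : Activity G)
    {i j : V} (hi : i ∈ u.1) (hj : j ∈ u.1) : c i = c j := by
  by_contra h
  have hadj := (hG i j).2 h
  exact u.2 (Finset.mem_coe.2 hi) (Finset.mem_coe.2 hj) hadj.ne hadj

theorem idle_notMem_activeIn (c : V → Fin K) (j : Fin K) : (idle : Activity G) ∉ activeIn c j := by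
  rw [mem_activeIn]; simp [idle]

theorem exists_mem_of_ne_idle {u : Activity G} (h : u ≠ idle) : ∃ i, i ∈ u.1 := by
  by_contra! h'
  exact h (Subtype.ext (Finset.eq_empty_of_forall_notMem h'))

theorem sum_conductance_idle_le (nu : V → ℝ) (hnu : ∀ i, 0 < nu i) (c : V → Fin K) (j : Fin K) :
    ∑ u ∈ activeIn c j, conductance (G := G) nu idle u ≤ ∑ i with c i = j, nu i := by
  have h : ∀ u : Activity G, conductance nu idle u = ∑ i, link i idle u * nu i := by
    intro u
    refine Finset.sum_congr rfl fun i _ => ?_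
    rw [link_mul_weight, weight_idle, mul_one, link_eq_zero (u := u), zero_mul, add_zero]
    intro h
    have := h.2
    simp [idle] at this
    exact absurd this.symm (Finset.insert_ne_empty _ _)
  simp only [h]
  rw [Finset.sum_comm, Finset.sum_filter]
  refine Finset.sum_le_sum fun i _ => ?_
  split_ifs with hi
  · refine le_trans (Finset.sum_le_sum_of_subset_of_nonneg (Finset.subset_univ _)
      fun u _ _ => mul_nonneg (link_nonneg _ _ _) (hnu i).le) ?_
    refine (sum_link_mul_le i idle (nu i) (hnu i).le).trans ?_
    split_ifs
    exacts [le_rfl, (hnu i).le]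
  · refine le_of_eq (Finset.sum_eq_zero fun u hu => ?_)
    rw [link_eq_zero, zero_mul]
    intro hl
    obtain ⟨i', hi', hci⟩ := mem_activeIn.1 hu
    rw [hl.2] at hi'
    simp [idle] at hi'
    exact hi (hi' ▸ hci)

open Classical in
/-- Outside of component `k = c i` the mean queue length at `i` is bounded below by bottleneck
quantities of the activity process. -/
theorem queue_bottleneck {c : V → Fin K} (hG : ∀ i j, G.Adj i j ↔ c i ≠ c j)
    (lam nu : V → ℝ) (hlam : ∀ i, 0 ≤ lam i) (hnu : ∀ i, 0 < nu i)
    (p : PMF (State G)) (hp : IsStationary (fixedRate G lam nu) p) (i : V) (hi : 0 < lam i)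
    (hπ : 0 < prob p idle)
    (hfin : ∀ u, mass p (fun l => (l i : ℝ≥0∞)) u ≠ ⊤) :
    (∀ j ≠ c i, lam i * prob p idle * (∑ u ∈ activeIn (G := G) c j, weight nu u) ^ 2
      ≤ (∑ i' with c i' = j, nu i') * ∑ u, qmass p i (fun n => n) u) ∧
    lam i * prob p idle * (∑ u ∈ (activeIn (G := G) c (c i))ᶜ, weight nu u) ^ 2
      ≤ (∑ i' with c i' = c i, nu i') * ∑ u, qmass p i (fun n => n) u := by
  set f : Activity G → ℝ := qmass p i (fun n => n) with hf
  set g : Activity G → ℝ := fun u => f u / weight nu u with hg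
  have hf0 : ∀ u, 0 ≤ f u := qmass_nonneg p i _
  have hg0 : ∀ u, 0 ≤ g u := fun u => div_nonneg (hf0 u) (weight_pos hnu u).le
  have hfg : ∀ u, weight nu u * g u = f u := fun u => mul_div_cancel₀ _ (weight_pos hnu u).ne'
  have hpoi := queue_poisson lam nu hlam hnu p hp i hfin
  rw [← hf] at hpoi
  have hc0 : 0 < lam i * prob p idle := mul_pos hi hπ
  have hprob := prob_eq_weight lam nu hlam hnu p hp i
  have hs := conductance_symm (G := G) nu
  have ha := conductance_nonneg (G := G) hnu
  -- the Poisson equation away from the component of `i`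
  have hpoi' : ∀ u : Activity G, u ≠ idle → u ∉ activeIn c (c i) →
      ∑ v, conductance nu u v * (g u - g v) = lam i * prob p idle * weight nu u := by
    intro u hu hu'
    rw [hpoi u, hprob u, Finset.sum_eq_zero, add_zero, mul_assoc]
    intro v _
    obtain ⟨j, hj⟩ := exists_mem_of_ne_idle hu
    rw [link_eq_zero, zero_mul]
    intro hl
    refine hl.1.2 j ((hG i j).2 fun h => ?_) hj
    exact hu' (mem_activeIn.2 ⟨j, hj, h.symm⟩)
  -- distinct components communicate through the idle state only
  have hsep : ∀ u v : Activity G, u ≠ idle → v ≠ idle → conductance nu u v ≠ 0 →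
      ∀ j, u ∈ activeIn c j → v ∈ activeIn c j := by
    intro u v hu hv huv j huj
    obtain ⟨a, ha', haj⟩ := mem_activeIn.1 huj
    by_contra hvj
    have key : ∀ w, w ∈ u.1 → w ∉ v.1 := by
      intro w hw hw'
      exact hvj (mem_activeIn.2 ⟨w, hw', (comp_eq_of_mem hG u hw ha').trans haj⟩)
    obtain ⟨b, hb⟩ := exists_mem_of_ne_idle hv
    refine huv (conductance_eq_zero nu (fun w hl => ?_) (fun w hl => ?_))
    · exact key a ha' (by rw [hl.2]; exact Finset.mem_insert_of_mem ha')
    · exact key b (by rw [hl.2]; exact Finset.mem_insert_of_mem hb) hb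
  have hmean : ∀ C : Finset (Activity G), ∑ u ∈ C, weight nu u * (g u - g idle) ≤ ∑ u, f u := by
    intro C
    refine le_trans (Finset.sum_le_sum fun u _ => ?_)
      (Finset.sum_le_sum_of_subset_of_nonneg (Finset.subset_univ C) fun u _ _ => hf0 u)
    rw [← hfg u]
    exact mul_le_mul_of_nonneg_left (by linarith [hg0 idle]) (weight_pos hnu u).le
  refine ⟨fun j hj => ?_, ?_⟩
  · obtain ⟨-, h⟩ := poisson_bottleneck (conductance nu) hs ha (activeIn c j) idle
      (idle_notMem_activeIn c j) (fun u hu v hv hv' => by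
        by_contra h
        exact hv (hsep u v (fun e => idle_notMem_activeIn c j (e ▸ hu)) hv' h j hu))
      g (weight nu) _ hc0 (fun u hu => hpoi' u (fun e => idle_notMem_activeIn c j (e ▸ hu))
        fun hu' => by
          obtain ⟨a, ha, haj⟩ := mem_activeIn.1 hu
          obtain ⟨b, hb, hbj⟩ := mem_activeIn.1 hu'
          exact hj (by rw [← haj, ← hbj]; exact comp_eq_of_mem hG u ha hb))
    refine h.trans ?_
    calc _ ≤ (∑ u ∈ activeIn c j, conductance nu idle u) * ∑ u, f u :=
          mul_le_mul_of_nonneg_left (hmean _) (Finset.sum_nonneg fun u _ => ha _ _)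
      _ ≤ _ := mul_le_mul_of_nonneg_right (sum_conductance_idle_le nu hnu c j)
          (Finset.sum_nonneg fun u _ => hf0 u)
  · set D : Finset (Activity G) := activeIn c (c i) with hD
    have hid : idle ∈ Dᶜ := by
      rw [Finset.mem_compl]; exact idle_notMem_activeIn c _
    set E : Finset (Activity G) := Dᶜ.erase idle with hE
    have hEmem : ∀ u, u ∈ E ↔ u ≠ idle ∧ u ∉ D := fun u => by simp [hE]
    obtain ⟨flux, h⟩ := poisson_bottleneck (conductance nu) hs ha E idle
      (fun h => ((hEmem _).1 h).1 rfl) (fun u hu v hv hv' => by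
        by_contra h
        rw [hEmem] at hu hv
        have hvD : v ∈ D := by
          by_contra hvD; exact hv ⟨hv', hvD⟩
        rw [hs] at h
        exact hu.2 (hsep v u hv' hu.1 h _ hvD))
      g (weight nu) _ hc0 (fun u hu => hpoi' u ((hEmem u).1 hu).1 ((hEmem u).1 hu).2)
    have hWc : ∑ u ∈ Dᶜ, weight nu u = 1 + ∑ u ∈ E, weight nu u := by
      rw [← Finset.add_sum_erase _ _ hid, weight_idle]
    -- A negative value would, by the bottleneck bound, force `E` to have weight zero, hence to be
    -- empty.
    have hE0 : 0 ≤ ∑ u ∈ E, weight nu u * (g u - g idle) := by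
      by_contra! hneg
      have h1 : (∑ u ∈ E, conductance nu idle u) * ∑ u ∈ E, weight nu u * (g u - g idle) ≤ 0 :=
        mul_nonpos_of_nonneg_of_nonpos (Finset.sum_nonneg fun u _ => ha _ _) hneg.le
      have h2 : (∑ u ∈ E, weight nu u) ^ 2 ≤ 0 := by
        by_contra! h2
        have := mul_pos hc0 h2
        linarith
      have h3 : ∑ u ∈ E, weight nu u = 0 := pow_eq_zero_iff two_ne_zero |>.1
        (le_antisymm h2 (sq_nonneg _))
      have h4 : E = ∅ := by
        by_contra hne
        exact (Finset.sum_pos (fun u _ => weight_pos hnu u)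
          (Finset.nonempty_iff_ne_empty.2 hne)).ne' h3
      rw [h4] at hneg
      simp at hneg
    -- the inequality at the idle state
    have hidle : lam i * prob p idle * ∑ u ∈ Dᶜ, weight nu u
        ≤ (∑ u ∈ D, conductance nu idle u) * g idle := by
      have h0 := hpoi idle
      -- The departure loss at `i` is at most the whole flow from `D` to the idle state, so it is
      -- absorbed by the `g v` terms of the Laplacian in `h2`.
      have h1 : -∑ v ∈ D, conductance nu idle v * g v ≤ ∑ v, link i idle v *
          (qmass p i (fun n => ((n - 1 : ℕ) : ℝ≥0∞)) v - f v) := by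
        rw [← Finset.sum_subset (Finset.subset_univ D), ← Finset.sum_neg_distrib]
        · refine Finset.sum_le_sum fun v _ => ?_
          have e1 := mul_le_mul_of_nonneg_right (link_mul_weight_le hnu i idle v) (hg0 v)
          rw [mul_assoc, hfg] at e1
          have e2 := mul_nonneg (link_nonneg i idle v)
            (qmass_nonneg p i (fun n => ((n - 1 : ℕ) : ℝ≥0∞)) v)
          linarith
        · intro v _ hv
          rw [link_eq_zero, zero_mul]
          intro hl
          refine hv (mem_activeIn.2 ⟨i, ?_, rfl⟩)
          rw [hl.2]; exact Finset.mem_insert_self _ _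
      have h2 : ∑ v, conductance nu idle v * (g idle - g v)
          = (∑ v ∈ D, conductance nu idle v) * g idle - ∑ v ∈ D, conductance nu idle v * g v
            - lam i * prob p idle * ∑ u ∈ E, weight nu u := by
        rw [← flux, ← Finset.sum_add_sum_compl D, ← Finset.add_sum_erase _ _ hid, sub_self,
          mul_zero, zero_add, Finset.sum_mul, ← Finset.sum_sub_distrib, sub_eq_add_neg,
          ← Finset.sum_neg_distrib]
        congr 1
        · exact Finset.sum_congr rfl fun v _ => by ring
        · exact Finset.sum_congr rfl fun v _ => by ring
      have h0' : ∑ v, conductance nu idle v * (g idle - g v) = lam i * prob p idle +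
          ∑ v, link i idle v * (qmass p i (fun n => ((n - 1 : ℕ) : ℝ≥0∞)) v - f v) := h0
      rw [hWc]
      linarith
    have htot : (∑ u ∈ Dᶜ, weight nu u) * g idle ≤ ∑ u, f u := by
      refine le_trans ?_ (Finset.sum_le_sum_of_subset_of_nonneg (Finset.subset_univ Dᶜ)
        fun u _ _ => hf0 u)
      have : ∑ u ∈ Dᶜ, f u = (∑ u ∈ Dᶜ, weight nu u) * g idle
          + ∑ u ∈ E, weight nu u * (g u - g idle) := by
        have e : ∑ u ∈ E, weight nu u * (g u - g idle)
            = ∑ u ∈ Dᶜ, weight nu u * (g u - g idle) := by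
          rw [← Finset.add_sum_erase _ _ hid]; simp [hE]
        rw [e, Finset.sum_mul, ← Finset.sum_add_distrib]
        exact Finset.sum_congr rfl fun u _ => by rw [← hfg u]; ring
      linarith
    have hW0 : 0 ≤ ∑ u ∈ Dᶜ, weight nu u := Finset.sum_nonneg fun u _ => (weight_pos hnu u).le
    have hS := sum_conductance_idle_le (G := G) nu hnu c (c i)
    have hS0 : 0 ≤ ∑ u ∈ D, conductance nu idle u := Finset.sum_nonneg fun u _ => ha _ _
    calc _ = (lam i * prob p idle * ∑ u ∈ Dᶜ, weight nu u) * ∑ u ∈ Dᶜ, weight nu u := by ring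
      _ ≤ (∑ u ∈ D, conductance nu idle u) * g idle * ∑ u ∈ Dᶜ, weight nu u :=
          mul_le_mul_of_nonneg_right hidle hW0
      _ = (∑ u ∈ D, conductance nu idle u) * ((∑ u ∈ Dᶜ, weight nu u) * g idle) := by ring
      _ ≤ (∑ u ∈ D, conductance nu idle u) * ∑ u, f u := mul_le_mul_of_nonneg_left htot hS0
      _ ≤ _ := mul_le_mul_of_nonneg_right hS (Finset.sum_nonneg fun u _ => hf0 u)

end Multipartite

end Activity

/-! ### From stability to load bounds and queue bounds. -/

section Bounds

variable {V : Type*} [DecidableEq V] [Fintype V] {G : SimpleGraph V} {K : ℕ}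

theorem meanQueue_eq_sum (p : PMF (State G)) (i : V) :
    meanQueue p i = ∑ u, mass p (fun l => (l i : ℝ≥0∞)) u := by
  rw [sum_mass]; rfl

/-- An infinite mean makes the bound trivial, so real arithmetic under finiteness suffices. -/
theorem ofReal_lt_meanQueue (p : PMF (State G)) (i : V) (b : ℝ)
    (h : (∀ u, mass p (fun l => (l i : ℝ≥0∞)) u ≠ ⊤) →
      0 < ∑ u, qmass p i (fun n => n) u ∧ b < ∑ u, qmass p i (fun n => n) u) :
    ENNReal.ofReal b < meanQueue p i := by
  by_cases htop : meanQueue p i = ⊤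
  · rw [htop]; exact ENNReal.ofReal_lt_top
  · rw [meanQueue_eq_sum] at htop ⊢
    have hfin : ∀ u, mass p (fun l => (l i : ℝ≥0∞)) u ≠ ⊤ := fun u =>
      ENNReal.sum_ne_top.1 htop u (Finset.mem_univ u)
    obtain ⟨h0, h1⟩ := h hfin
    have : ∑ u, mass p (fun l => (l i : ℝ≥0∞)) u
        = ENNReal.ofReal (∑ u, qmass p i (fun n => n) u) := by
      rw [ENNReal.ofReal_sum_of_nonneg fun u _ => qmass_nonneg _ _ _ _]
      exact Finset.sum_congr rfl fun u _ => (ENNReal.ofReal_toReal (hfin u)).symm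
    rw [this]
    exact (ENNReal.ofReal_lt_ofReal_iff h0).2 h1

theorem lam_le_prob_active (lam nu : V → ℝ) (hlam : ∀ i, 0 ≤ lam i) (hnu : ∀ i, 0 < nu i)
    (p : PMF (State G)) (hp : IsStationary (fixedRate G lam nu) p) (i : V) :
    lam i ≤ ∑ u : Activity G, if i ∈ u.1 then prob p u else 0 := by
  refine (lam_le_activity lam nu hlam hnu p hp i).trans ?_
  rw [Finset.sum_comm]
  exact Finset.sum_le_sum fun v _ => sum_link_mul_le' i v _ (prob_nonneg p v)

open Classical in
theorem lam_le_prob_unblocked (lam nu : V → ℝ) (hlam : ∀ i, 0 ≤ lam i) (hnu : ∀ i, 0 < nu i)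
    (p : PMF (State G)) (hp : IsStationary (fixedRate G lam nu) p) (i : V) :
    lam i ≤ nu i * ∑ u : Activity G, if Unblocked G u.1 i then prob p u else 0 := by
  refine (lam_le_activity lam nu hlam hnu p hp i).trans ?_
  rw [Finset.mul_sum]
  refine Finset.sum_le_sum fun u _ => ?_
  have : ∀ v, link i u v * prob p v = link i u v * (nu i * prob p u) := by
    intro v
    rw [prob_eq_weight lam nu hlam hnu p hp i v, prob_eq_weight lam nu hlam hnu p hp i u]
    linear_combination prob p idle * link_mul_weight nu i u v
  rw [Finset.sum_congr rfl fun v _ => this v]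
  refine (sum_link_mul_le i u _ (mul_nonneg (hnu i).le (prob_nonneg p u))).trans (le_of_eq ?_)
  rw [mul_ite, mul_zero]

theorem prob_idle_pos (lam nu : V → ℝ) (hlam : ∀ i, 0 ≤ lam i) (hnu : ∀ i, 0 < nu i)
    (p : PMF (State G)) (hp : IsStationary (fixedRate G lam nu) p) (i : V) :
    0 < prob p (idle : Activity G) := by
  refine lt_of_le_of_ne (prob_nonneg p _) fun h => ?_
  have := sum_prob p
  rw [Finset.sum_eq_zero fun u _ => by
    rw [prob_eq_weight lam nu hlam hnu p hp i u, ← h, zero_mul]] at this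
  exact zero_ne_one this

theorem sum_prob_eq_weight (lam nu : V → ℝ) (hlam : ∀ i, 0 ≤ lam i) (hnu : ∀ i, 0 < nu i)
    (p : PMF (State G)) (hp : IsStationary (fixedRate G lam nu) p) (i : V)
    (C : Finset (Activity G)) :
    ∑ u ∈ C, prob p u = prob p idle * ∑ u ∈ C, weight nu u := by
  rw [Finset.mul_sum]
  exact Finset.sum_congr rfl fun u _ => prob_eq_weight lam nu hlam hnu p hp i u

open Classical in
/-- At most one component is active. -/
theorem sum_indicator_le {c : V → Fin K} (hG : ∀ i j, G.Adj i j ↔ c i ≠ c j) (r : Fin K → V)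
    (hr : ∀ k, c (r k) = k) (T : Finset (Fin K)) (P : Activity G → Prop)
    (hP : ∀ u k, k ∈ T → r k ∈ u.1 → P u) (u : Activity G) :
    ∑ k ∈ T, (if r k ∈ u.1 then (1 : ℝ) else 0) ≤ if P u then 1 else 0 := by
  by_cases h : ∃ k ∈ T, r k ∈ u.1
  · obtain ⟨k, hk, hku⟩ := h
    rw [Finset.sum_eq_single_of_mem k hk, if_pos hku, if_pos (hP u k hk hku)]
    intro k' _ hk'
    rw [if_neg]
    intro h'
    apply hk'
    have := comp_eq_of_mem hG u h' hku
    rwa [hr, hr] at this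
  · push Not at h
    rw [Finset.sum_eq_zero fun k hk => if_neg (h k hk)]
    split_ifs <;> norm_num

open Classical in
-- Representatives of distinct components are active on disjoint events, so their activity
-- probabilities add up inside `C`.
theorem sum_lam_le {c : V → Fin K} (hG : ∀ i j, G.Adj i j ↔ c i ≠ c j)
    (lam nu : V → ℝ) (hlam : ∀ i, 0 ≤ lam i) (hnu : ∀ i, 0 < nu i)
    (p : PMF (State G)) (hp : IsStationary (fixedRate G lam nu) p) (r : Fin K → V)
    (hr : ∀ k, c (r k) = k) (T : Finset (Fin K)) (C : Finset (Activity G))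
    (hC : ∀ u k, k ∈ T → r k ∈ u.1 → u ∈ C) :
    ∑ k ∈ T, lam (r k) ≤ ∑ u ∈ C, prob p u := by
  refine (Finset.sum_le_sum fun k _ => lam_le_prob_active lam nu hlam hnu p hp (r k)).trans ?_
  rw [Finset.sum_comm, ← Finset.filter_univ_mem C, Finset.sum_filter]
  refine Finset.sum_le_sum fun u _ => ?_
  have := mul_le_mul_of_nonneg_right (sum_indicator_le hG r hr T (fun u => u ∈ C) hC u) (prob_nonneg p u)
  simpa only [Finset.sum_mul, ite_mul, one_mul, zero_mul] using this

open Classical in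
/-- The load is less than one, and it forces large activation rates. -/
theorem load_bound {c : V → Fin K} (hG : ∀ i j, G.Adj i j ↔ c i ≠ c j)
    (lam nu : V → ℝ) (hlam : ∀ i, 0 ≤ lam i) (hnu : ∀ i, 0 < nu i)
    (p : PMF (State G)) (hp : IsStationary (fixedRate G lam nu) p) (r : Fin K → V)
    (hr : ∀ k, c (r k) = k) (i : V) (hi : r (c i) = i) :
    ∑ k, lam (r k) < 1 ∧ lam i ≤ nu i * (1 - ∑ k, lam (r k)) := by
  have h1 : ∑ k, lam (r k) ≤ ∑ u : Activity G with ¬ Unblocked G u.1 i, prob p u := by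
    refine sum_lam_le hG lam nu hlam hnu p hp r hr Finset.univ _ fun u k _ hk =>
      Finset.mem_filter.2 ⟨Finset.mem_univ _, fun hub => ?_⟩
    by_cases h : k = c i
    · rw [h, hi] at hk; exact hub.1 hk
    · exact hub.2 _ ((hG i (r k)).2 (by rw [hr]; exact Ne.symm h)) hk
  have h2 : ∑ u : Activity G with Unblocked G u.1 i, prob p u
      + ∑ u : Activity G with ¬ Unblocked G u.1 i, prob p u = 1 := by
    rw [← sum_prob p]
    exact Finset.sum_filter_add_sum_filter_not _ _ _
  have h3 := lam_le_prob_unblocked lam nu hlam hnu p hp i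
  rw [← Finset.sum_filter] at h3
  -- The positive idle probability makes `rho < 1` strict.
  have h4 : prob p idle ≤ ∑ u : Activity G with Unblocked G u.1 i, prob p u :=
    Finset.single_le_sum (f := prob p) (fun u _ => prob_nonneg p u)
      (Finset.mem_filter.2 ⟨Finset.mem_univ _, by simp [Unblocked, idle]⟩)
  have h5 := prob_idle_pos lam nu hlam hnu p hp i
  refine ⟨by linarith, h3.trans (mul_le_mul_of_nonneg_left (by linarith) (hnu i).le)⟩

/-- The fully active state of a component dominates its weight. -/
theorem weight_activeIn_ge {c : V → Fin K} (hG : ∀ i j, G.Adj i j ↔ c i ≠ c j) (nu : V → ℝ)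
    (hnu : ∀ i, 0 < nu i) (j : Fin K) (hj : 0 < compSize c j) (x : ℝ) (hx : 0 ≤ x)
    (hxnu : ∀ i, c i = j → x ≤ nu i) :
    (∑ i with c i = j, nu i) * x ^ (compSize c j - 1)
      ≤ compSize c j * ∑ u ∈ activeIn (G := G) c j, weight nu u := by
  set A : Finset V := Finset.univ.filter fun i => c i = j with hA
  have hind : G.IsIndepSet (A : Set V) := by
    intro a ha b hb _ hadj
    simp only [hA, Finset.coe_filter, Finset.mem_univ, true_and, Set.mem_ofPred_eq] at ha hb
    exact (hG a b).1 hadj (ha.trans hb.symm)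
  have hprod : ∏ i ∈ A, nu i ≤ ∑ u ∈ activeIn (G := G) c j, weight nu u := by
    refine Finset.single_le_sum (f := weight nu) (a := (⟨A, hind⟩ : Activity G))
      (fun u _ => (weight_pos hnu u).le) ?_
    obtain ⟨i, hi⟩ := Finset.card_pos.1 hj
    exact mem_activeIn.2 ⟨i, hi, (Finset.mem_filter.1 hi).2⟩
  calc (∑ i ∈ A, nu i) * x ^ (compSize c j - 1)
      = ∑ i ∈ A, nu i * x ^ (compSize c j - 1) := Finset.sum_mul _ _ _
    _ ≤ ∑ i ∈ A, ∏ i' ∈ A, nu i' := by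
        -- In the product over the component, keep the factor `nu i` and bound the others below by
        -- `x`.
        refine Finset.sum_le_sum fun i hi => ?_
        rw [← Finset.mul_prod_erase A nu hi]
        refine mul_le_mul_of_nonneg_left ?_ (hnu i).le
        have : compSize c j - 1 = (A.erase i).card := (Finset.card_erase_of_mem hi).symm
        rw [this, ← Finset.prod_const]
        refine Finset.prod_le_prod (fun _ _ => hx) fun i' hi' => hxnu i' ?_
        exact (Finset.mem_filter.1 (Finset.mem_of_mem_erase hi')).2
    _ = compSize c j * ∏ i ∈ A, nu i := by rw [Finset.sum_const, nsmul_eq_mul]; rfl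
    _ ≤ _ := mul_le_mul_of_nonneg_left hprod (Nat.cast_nonneg _)

open Classical in
/-- Bottleneck bounds for the mean queue length in terms of component probabilities. -/
theorem queue_bound {c : V → Fin K} (hG : ∀ i j, G.Adj i j ↔ c i ≠ c j)
    (lam nu : V → ℝ) (hlam : ∀ i, 0 ≤ lam i) (hnu : ∀ i, 0 < nu i)
    (p : PMF (State G)) (hp : IsStationary (fixedRate G lam nu) p) (i : V) (hi : 0 < lam i)
    (hfin : ∀ u, mass p (fun l => (l i : ℝ≥0∞)) u ≠ ⊤)
    (j : Fin K) (hj : 0 < compSize c j) (x : ℝ) (hx : 0 ≤ x) (hxnu : ∀ i, c i = j → x ≤ nu i) :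
    0 < ∑ u, qmass p i (fun n => n) u ∧
    (j ≠ c i → lam i * (∑ u ∈ activeIn (G := G) c j, prob p u) * x ^ (compSize c j - 1)
      ≤ compSize c j * ∑ u, qmass p i (fun n => n) u) ∧
    (j = c i → lam i * (∑ u ∈ (activeIn (G := G) c j)ᶜ, prob p u) ^ 2 * x ^ (compSize c j - 1)
      ≤ (∑ u ∈ activeIn (G := G) c j, prob p u)
        * (compSize c j * ∑ u, qmass p i (fun n => n) u)) := by
  have hπ := prob_idle_pos lam nu hlam hnu p hp i
  obtain ⟨hb1, hb2⟩ := queue_bottleneck hG lam nu hlam hnu p hp i hi hπ hfin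
  have hW := weight_activeIn_ge hG nu hnu j hj x hx hxnu
  rw [sum_prob_eq_weight lam nu hlam hnu p hp i, sum_prob_eq_weight lam nu hlam hnu p hp i]
  set E := ∑ u, qmass p i (fun n => n) u
  set W := ∑ u ∈ activeIn (G := G) c j, weight nu u
  set s := ∑ i with c i = j, nu i with hs
  set π := prob p (idle : Activity G)
  have hs0 : 0 < s := Finset.sum_pos (fun i _ => hnu i) (Finset.card_pos.1 hj)
  have hW0 : 0 ≤ W := Finset.sum_nonneg fun u _ => (weight_pos hnu u).le
  refine ⟨?_, fun hji => ?_, fun hji => ?_⟩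
  · have hpos : 0 < ∑ u ∈ (activeIn (G := G) c (c i))ᶜ, weight nu u :=
      Finset.sum_pos (fun u _ => weight_pos hnu u)
        ⟨idle, Finset.mem_compl.2 (idle_notMem_activeIn c _)⟩
    have h1 : 0 < (∑ i' with c i' = c i, nu i') * E :=
      lt_of_lt_of_le (by positivity) hb2
    exact pos_of_mul_pos_right h1 (Finset.sum_nonneg fun i _ => (hnu i).le)
  · refine le_of_mul_le_mul_left ?_ hs0
    calc s * (lam i * (π * W) * x ^ (compSize c j - 1))
        = lam i * π * W * (s * x ^ (compSize c j - 1)) := by ring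
      _ ≤ lam i * π * W * (compSize c j * W) := mul_le_mul_of_nonneg_left hW (by positivity)
      _ = compSize c j * (lam i * π * W ^ 2) := by ring
      _ ≤ compSize c j * (s * E) := mul_le_mul_of_nonneg_left (hb1 j hji) (Nat.cast_nonneg _)
      _ = _ := by ring
  · rw [← hji] at hb2
    set Wc := ∑ u ∈ (activeIn (G := G) c j)ᶜ, weight nu u
    refine le_of_mul_le_mul_left ?_ hs0
    calc s * (lam i * (π * Wc) ^ 2 * x ^ (compSize c j - 1))
        = lam i * (π * Wc) ^ 2 * (s * x ^ (compSize c j - 1)) := by ring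
      _ ≤ lam i * (π * Wc) ^ 2 * (compSize c j * W) :=
          mul_le_mul_of_nonneg_left hW (by positivity)
      _ = compSize c j * W * π * (lam i * π * Wc ^ 2) := by ring
      _ ≤ compSize c j * W * π * (s * E) := mul_le_mul_of_nonneg_left hb2 (by positivity)
      _ = _ := by ring

theorem sum_activeIn_add_compl (p : PMF (State G)) (c : V → Fin K) (j : Fin K)
    [DecidableEq (Activity G)] :
    ∑ u ∈ activeIn (G := G) c j, prob p u + ∑ u ∈ (activeIn (G := G) c j)ᶜ, prob p u = 1 := by
  rw [Finset.sum_add_sum_compl, sum_prob]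

end Bounds

end RandomAccess

end

/-! ### Assembly of the two lower bounds. -/

open RandomAccess

theorem theorem2 {V : Type*} [Fintype V] [DecidableEq V] (K : ℕ) (G : SimpleGraph V)
    (c : V → Fin K) (hc : Function.Surjective c)
    (hG : ∀ i j, G.Adj i j ↔ c i ≠ c j)
    (rhoHat : Fin K → ℝ) (hrho : ∀ k, 0 ≤ rhoHat k)
    (lam : V → ℝ) (hlam : ∀ i, lam i = rhoHat (c i))
    (nu : V → ℝ) (hnu : ∀ i, 0 < nu i)
    (M : ℕ) (hM : M = RandomAccess.maxCompSize c)
    (rho : ℝ) (hrhosum : rho = ∑ k, rhoHat k)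
    (rhoMin : ℝ) (hrhoMin : IsLeast (Set.range rhoHat) rhoMin)
    (p : PMF (RandomAccess.State G))
    (hp : RandomAccess.IsStationary (RandomAccess.fixedRate G lam nu) p) :
    rho < 1 ∧
    (2 ≤ K → ∀ (k : Fin K) (S : Finset V) (w : V → ℝ), (∀ i ∈ S, c i = k) → (∀ i, 0 ≤ w i) →
      0 < ∑ i ∈ S, w i * lam i →
      ENNReal.ofReal (1 / (2 * (M : ℝ)) * rhoMin ^ (M + 1) * (∑ i ∈ S, w i * lam i)
          * (1 / (1 - rho)) ^ (M - 1))
        < ∑ i ∈ S, ENNReal.ofReal (w i) * RandomAccess.meanQueue p i) ∧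
    ((∀ k, RandomAccess.compSize c k = M) → (∀ k, rhoHat k = rho / (K : ℝ)) → 0 < rho →
      ∀ i : V,
        ENNReal.ofReal (((K : ℝ) - 1) ^ 2 * rho ^ (M + 2)
            / (2 * (M : ℝ) * (K : ℝ) ^ (M + 1) * ((K : ℝ) - ((K : ℝ) - 1) * rho))
            * (1 / (1 - rho)) ^ (M - 1))
          < RandomAccess.meanQueue p i) := by
  classical

  have hlam0 : ∀ i, 0 ≤ lam i := fun i => by rw [hlam]; exact hrho _
  obtain ⟨k₀, hk₀⟩ := hrhoMin.1
  have hmin : ∀ k, rhoMin ≤ rhoHat k := fun k => hrhoMin.2 ⟨k, rfl⟩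
  have hmin0 : 0 ≤ rhoMin := hk₀ ▸ hrho k₀
  -- a system of representatives through a prescribed node
  have hrep : ∀ i : V, ∃ r : Fin K → V, (∀ k, c (r k) = k) ∧ r (c i) = i := by
    intro i
    choose r hr using hc
    refine ⟨Function.update r (c i) i, fun k => ?_, Function.update_self _ _ _⟩
    by_cases hk : k = c i
    · subst hk; simp
    · rw [Function.update_of_ne hk, hr]
  have hload : ∀ i, rho < 1 ∧ lam i ≤ nu i * (1 - rho) := by
    intro i
    obtain ⟨r, hr, hri⟩ := hrep i
    have := load_bound hG lam nu hlam0 hnu p hp r hr i hri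
    simpa only [hlam, hr, ← hrhosum] using this
  obtain ⟨i₀, -⟩ := hc k₀
  have hrho1 : rho < 1 := (hload i₀).1
  have hy : 0 < 1 / (1 - rho) := by
    have : 0 < 1 - rho := by linarith
    positivity
  have hnuge : ∀ i, rhoHat (c i) * (1 / (1 - rho)) ≤ nu i := by
    intro i
    rw [mul_one_div, div_le_iff₀ (by linarith), ← hlam]
    exact (hload i).2
  have hsize : ∀ k, 0 < compSize c k := fun k => by
    obtain ⟨i, hi⟩ := hc k
    exact Finset.card_pos.2 ⟨i, by simp [hi]⟩
  have hactive : ∀ j, rhoHat j ≤ ∑ u ∈ activeIn (G := G) c j, prob p u := by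
    intro j
    obtain ⟨r, hr, -⟩ := hrep i₀
    have := sum_lam_le hG lam nu hlam0 hnu p hp r hr {j} (activeIn c j)
      (fun u k hk hu => mem_activeIn.2 ⟨r k, hu, by rw [hr]; exact Finset.mem_singleton.1 hk⟩)
    simpa [hlam, hr] using this
  have hcompl : ∀ j, rho - rhoHat j ≤ ∑ u ∈ (activeIn (G := G) c j)ᶜ, prob p u := by
    intro j
    obtain ⟨r, hr, -⟩ := hrep i₀
    have := sum_lam_le hG lam nu hlam0 hnu p hp r hr (Finset.univ.erase j)
      (activeIn c j)ᶜ (fun u k hk hu => by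
        rw [Finset.mem_compl, mem_activeIn]
        rintro ⟨a, ha, haj⟩
        have := comp_eq_of_mem hG u ha hu
        rw [haj, hr] at this
        exact Finset.ne_of_mem_erase hk this.symm)
    simp only [hlam, hr] at this
    have e := Finset.add_sum_erase Finset.univ rhoHat (Finset.mem_univ j)
    linarith
  have hsplit := fun j => sum_activeIn_add_compl p c j
  have hprob0 : ∀ C : Finset (Activity G), 0 ≤ ∑ u ∈ C, prob p u := fun C =>
    Finset.sum_nonneg fun u _ => prob_nonneg p u
  refine ⟨hrho1, fun hK k S w hS hw hpos => ?_, fun hsym hrhosym hrhopos i => ?_⟩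
  · -- a component of maximal size
    obtain ⟨j, -, hjM⟩ := Finset.exists_mem_eq_sup Finset.univ ⟨k, Finset.mem_univ k⟩ (compSize c)
    have hjM : compSize c j = M := by rw [hM]; exact hjM.symm
    have hM0 : 0 < M := hjM ▸ hsize j
    have hMR : (0 : ℝ) < M := Nat.cast_pos.2 hM0
    set B := 1 / (2 * (M : ℝ)) * rhoMin ^ (M + 1) * (1 / (1 - rho)) ^ (M - 1) with hB
    have hB0 : 0 ≤ B := by positivity
    have hother : ∃ j' : Fin K, j' ≠ k := by
      have : Nontrivial (Fin K) := Fin.nontrivial_iff_two_le.2 hK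
      exact exists_ne k
    have hmin1 : rhoMin ≤ 1 := (hmin k₀).trans (by
      have := Finset.single_le_sum (f := rhoHat) (fun k _ => hrho k) (Finset.mem_univ k₀)
      linarith)
    have hnode : ∀ i, c i = k → 0 < lam i → ENNReal.ofReal (lam i * B) < meanQueue p i := by
      intro i hik hli
      refine ofReal_lt_meanQueue p i _ fun hfin => ?_
      obtain ⟨hE, h1, h2⟩ := queue_bound hG lam nu hlam0 hnu p hp i hli hfin j (hsize j)
        (rhoMin * (1 / (1 - rho))) (by positivity) (fun a ha =>
          (mul_le_mul_of_nonneg_right (hmin j) hy.le).trans (ha ▸ hnuge a))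
      rw [hjM] at h1 h2
      set E := ∑ u, qmass p i (fun n => n) u
      set X := (rhoMin * (1 / (1 - rho))) ^ (M - 1) with hX
      have hX0 : 0 ≤ X := by positivity
      -- If `j` is the component of `i`, the square comes from the complement, which has probability
      -- at least `rhoMin` because `K ≥ 2`; otherwise `rhoMin ^ 2 ≤ rhoMin ≤ P(j active)`.
      have key : lam i * rhoMin ^ 2 * X ≤ M * E := by
        by_cases hji : j = c i
        · have hc1 : rhoMin ≤ ∑ u ∈ (activeIn (G := G) c j)ᶜ, prob p u := by
            obtain ⟨j', hj'⟩ := hother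
            rw [← hik, ← hji] at hj'
            refine le_trans ?_ (hcompl j)
            have e := Finset.add_sum_erase Finset.univ rhoHat (Finset.mem_univ j)
            have e' := Finset.single_le_sum (f := rhoHat) (fun k _ => hrho k)
              (Finset.mem_erase.2 ⟨hj', Finset.mem_univ j'⟩)
            linarith [hmin j']
          have hle : ∑ u ∈ activeIn (G := G) c j, prob p u ≤ 1 := by
            linarith [hsplit j, hprob0 (activeIn (G := G) c j)ᶜ]
          calc lam i * rhoMin ^ 2 * X
              ≤ lam i * (∑ u ∈ (activeIn (G := G) c j)ᶜ, prob p u) ^ 2 * X := by gcongr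
            _ ≤ _ := h2 hji
            _ ≤ 1 * (M * E) := mul_le_mul_of_nonneg_right hle (by positivity)
            _ = M * E := one_mul _
        · have : rhoMin ^ 2 ≤ ∑ u ∈ activeIn (G := G) c j, prob p u := by
            have := hactive j
            have := hmin j
            nlinarith
          calc lam i * rhoMin ^ 2 * X
              ≤ lam i * (∑ u ∈ activeIn (G := G) c j, prob p u) * X := by gcongr
            _ ≤ _ := h1 hji
      have hBX : 2 * (lam i * B) * M = lam i * rhoMin ^ 2 * X := by
        rw [hB, hX, mul_pow]
        have : rhoMin ^ (M + 1) = rhoMin ^ 2 * rhoMin ^ (M - 1) := by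
          rw [← pow_add]; congr 1; omega
        rw [this]
        field_simp
      refine ⟨hE, ?_⟩
      have : 2 * (lam i * B) ≤ E := by
        refine le_of_mul_le_mul_right ?_ hMR
        linarith
      linarith
    -- Strictness is available only at nodes with positive weight and load, so the other terms are
    -- dropped.
    have hne : (S.filter fun i => 0 < w i * lam i).Nonempty := by
      by_contra hne
      rw [Finset.not_nonempty_iff_eq_empty, Finset.filter_eq_empty_iff] at hne
      exact absurd hpos (not_lt.2 (Finset.sum_nonpos fun i hi => not_lt.1 (hne hi)))
    have hsum : ∑ i ∈ S, w i * lam i = ∑ i ∈ S with 0 < w i * lam i, w i * lam i := by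
      rw [Finset.sum_filter_of_ne]
      exact fun i _ hi => lt_of_le_of_ne (mul_nonneg (hw i) (hlam0 i)) (Ne.symm hi)
    calc _ = ENNReal.ofReal (∑ i ∈ S with 0 < w i * lam i, w i * (lam i * B)) := by
          congr 1
          rw [hsum, hB, Finset.mul_sum, Finset.sum_mul]
          exact Finset.sum_congr rfl fun i _ => by ring
      _ = ∑ i ∈ S with 0 < w i * lam i, ENNReal.ofReal (w i) * ENNReal.ofReal (lam i * B) := by
          rw [ENNReal.ofReal_sum_of_nonneg fun i _ =>
            mul_nonneg (hw i) (mul_nonneg (hlam0 i) hB0)]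
          exact Finset.sum_congr rfl fun i _ => ENNReal.ofReal_mul (hw i)
      _ < ∑ i ∈ S with 0 < w i * lam i, ENNReal.ofReal (w i) * meanQueue p i := by
          refine ENNReal.sum_lt_sum_of_nonempty hne fun i hi => ?_
          obtain ⟨hiS, hi⟩ := Finset.mem_filter.1 hi
          have hwi : 0 < w i := pos_of_mul_pos_left hi (hlam0 i)
          exact (ENNReal.mul_lt_mul_iff_right (ENNReal.ofReal_pos.2 hwi).ne'
            ENNReal.ofReal_ne_top).2
            (hnode i (hS i hiS) (pos_of_mul_pos_right hi (hw i)))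
      _ ≤ _ := Finset.sum_le_sum_of_subset (Finset.filter_subset _ _)
  · have hM0 : 0 < M := hsym (c i) ▸ hsize (c i)
    have hMR : (0 : ℝ) < M := Nat.cast_pos.2 hM0
    have hK1 : (1 : ℝ) ≤ K := by
      have : 0 < K := Fin.pos (c i)
      exact_mod_cast this
    have hK0 : (0 : ℝ) < K := by linarith
    have hden : 0 < (K : ℝ) - (K - 1) * rho := by nlinarith
    have hli : lam i = rho / K := by rw [hlam, hrhosym]
    have hli0 : 0 < lam i := by rw [hli]; positivity
    refine ofReal_lt_meanQueue p i _ fun hfin => ?_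
    obtain ⟨hE, -, h2⟩ := queue_bound hG lam nu hlam0 hnu p hp i hli0 hfin (c i) (hsize _)
      (rho / K * (1 / (1 - rho))) (by positivity) (fun a ha => by
        rw [← hrhosym (c a)]; exact hnuge a)
    have h2 := h2 rfl
    rw [hsym] at h2
    set E := ∑ u, qmass p i (fun n => n) u
    set X := (rho / K * (1 / (1 - rho))) ^ (M - 1) with hX
    have hX0 : 0 ≤ X := by positivity
    have hq := hcompl (c i)
    have hq' := hsplit (c i)
    rw [hrhosym] at hq
    have e1 : rho - rho / K = (K - 1) * rho / K := by field_simp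
    have e2 : 1 - (K - 1) * rho / K = ((K : ℝ) - (K - 1) * rho) / K := by field_simp
    have hq0 : 0 ≤ (K - 1) * rho / K := div_nonneg (mul_nonneg (by linarith) hrhopos.le) hK0.le
    have key : lam i * ((K - 1) * rho / K) ^ 2 * X
        ≤ ((K : ℝ) - (K - 1) * rho) / K * (M * E) := by
      rw [e1] at hq
      calc lam i * ((K - 1) * rho / K) ^ 2 * X
          ≤ lam i * (∑ u ∈ (activeIn (G := G) c (c i))ᶜ, prob p u) ^ 2 * X := by gcongr
        _ ≤ _ := h2
        -- The component of `i` is active with probability at most `1 - (K - 1) * rho / K`, the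
        -- source of the factor `K - (K - 1) * rho`.
        _ ≤ _ := mul_le_mul_of_nonneg_right (by linarith) (by positivity)
    refine ⟨hE, ?_⟩
    set b := ((K : ℝ) - 1) ^ 2 * rho ^ (M + 2)
      / (2 * (M : ℝ) * (K : ℝ) ^ (M + 1) * ((K : ℝ) - ((K : ℝ) - 1) * rho))
      * (1 / (1 - rho)) ^ (M - 1) with hb
    have hbX : lam i * ((K - 1) * rho / K) ^ 2 * X
        = ((K : ℝ) - (K - 1) * rho) / K * (M * (2 * b)) := by
      rw [hb, hX, hli, mul_pow, div_pow rho]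
      obtain ⟨m, rfl⟩ : ∃ m, M = m + 1 := ⟨M - 1, by omega⟩
      rw [Nat.add_sub_cancel]
      generalize (1 / (1 - rho)) ^ m = Y
      generalize (K : ℝ) - (K - 1) * rho = D at hden
      field_simp
      ring
    rw [hbX] at key
    have h3 : M * (2 * b) ≤ M * E := le_of_mul_le_mul_left key (by positivity)
    have h4 : 2 * b ≤ E := le_of_mul_le_mul_left h3 hMR
    linarith
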